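/- Let $n \in \mathbb{N}$ and let $\mu$ be a finite positive Borel measure on $\mathbb{R}^n$ satisfying the multivariate Carleman condition: for each $i = 1, \dots, n$, $$\sum_{k=1}^{\infty} y_{i,2k}^{-1/(2k)} = +\infty, \qquad y_{i,2k} := \int_{\mathbb{R}^n} x_i^{2k}\, d\mu(x) \in [0,+\infty],$$ with the conventions $(+\infty)^{-1/(2k)} = 0$ and $0^{-1/(2k)} = +\infty$. Let $P := \{p \in \mathbb{R}[x_1,\dots,x_n] : p(x) \ge 0 \ \text{for all } x \in \mathbb{R}^n\}$ be the cone of globally nonnegative polynomials, and let $\Sigma := \{\sum_k q_k^2 \ \text{(finite sums)} : q_k \in \mathbb{R}[x_1,\dots,x_n]\} \subset P$ be the cone of sums of squares of polynomials. Then every polynomial belongs to $L^2(\mu)$, and $\Sigma$ is dense in $P$ with respect to $L^2(\mu)$, i.e. $\Sigma \subset P$ and $P$ is contained in the closure of $\Sigma$ in $L^2(\mu)$. Equivalently, for every $p \in P$ and every $\varepsilon > 0$ there exists $s \in \Sigma$ such that $\|p - s\|_{L^2(\mu)} < \varepsilon$. -/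

import Mathlib

open MeasureTheory

namespace SOSDensity

/-- The even marginal moment `y_{i,2k} = ∫ x_i^{2k} dμ`, with values in `[0, ∞]`. -/
noncomputable def evenMoment {n : ℕ} (μ : Measure (Fin n → ℝ)) (i : Fin n) (k : ℕ) : ENNReal :=
  ∫⁻ x, ENNReal.ofReal (x i ^ (2 * k)) ∂μ

/-- The multivariate Carleman condition: for every coordinate `i`, the series
`∑_{k ≥ 1} y_{i,2k}^{-1/(2k)}` diverges to `+∞`. The terms are taken in `[0, ∞]`, where
`∞` to a negative power is `0` and `0` to a negative power is `∞`.
The summation index is shifted by one, so that it starts at `0`. -/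
def Carleman {n : ℕ} (μ : Measure (Fin n → ℝ)) : Prop :=
  ∀ i : Fin n,
    ∑' k : ℕ, evenMoment μ i (k + 1) ^ (-(1 / (2 * ((k : ℝ) + 1)))) = ⊤

/-- The cone `P` of globally nonnegative polynomials in `n` real variables. -/
def nonnegPolys (n : ℕ) : Set (MvPolynomial (Fin n) ℝ) :=
  {p | ∀ x : Fin n → ℝ, 0 ≤ MvPolynomial.eval x p}

/-- The cone `Σ` of finite sums of squares of polynomials in `n` real variables. -/
def sosPolys (n : ℕ) : Set (MvPolynomial (Fin n) ℝ) :=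
  {p | IsSumSq p}

/-- The elements of the Hilbert space `L²(μ)` that are classes of polynomials from the set `S`. -/
def classesL2 {n : ℕ} (μ : Measure (Fin n → ℝ)) (S : Set (MvPolynomial (Fin n) ℝ)) :
    Set (Lp ℝ 2 μ) :=
  {f | ∃ p ∈ S, (f : (Fin n → ℝ) → ℝ) =ᵐ[μ] fun x => MvPolynomial.eval x p}

end SOSDensity

/-!
A nonnegative polynomial `p` is the square of the continuous function `√p`. If polynomials `A`
approximate `√p` in `L⁴(μ)`, then the squares `A²` approximate `p` in `L²(μ)`, by Hölder's inequality
applied to `p - A² = (√p - A) (√p + A)` (`exists_sq_near`). So it suffices to approximate continuous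
functions of polynomial growth by polynomials in `L⁴(μ)` (`exists_eLpNorm_sub_eval_lt`).

The Carleman condition enters through quasi-analyticity. Call a bounded continuous function `h` tame if
`p h` is an `L⁴(μ)`-limit of polynomials for every polynomial `p`. If `h` is tame, then so is
`exp(i s x_k) h` (`IsTame.mul_exp`): the map `s ↦ p exp(i s x_k) h`, with values in `L⁴(μ)` modulo the
closure of the polynomials, has all derivatives zero at `s = 0`, and its `j`-th derivative is bounded by
a constant times the `L⁸(μ)` norm of `x_k^j`. Bang's proof of the Denjoy–Carleman theorem shows that
such a map vanishes. The proof needs only Taylor's inequality between the norms of the derivatives, so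
it is stated for arrays of numbers (`bang_vanishing`) and applied to the distances to the polynomials
(`polyDist`); no dual spaces or derivatives occur. The divergence it requires is that of the ratios of
consecutive norms, which follows from the Carleman condition by Carleman's inequality
(`summable_geom_mean`) and log-convexity of the moments.

Consequently every polynomial in the functions `sin (x_k / R)` is tame. A continuous function `f` of
polynomial growth is the limit in `L⁴(μ)`, as `R → ∞`, of `f (R sin (x_1 / R), …, R sin (x_n / R))`, by
dominated convergence, and for each `R` the Stone–Weierstrass theorem on the cube approximates this
function uniformly by polynomials in sines.
-/

namespace SOSDensity

/-! ### Carleman's inequality -/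

/-- The arithmetic-geometric mean inequality for the numbers `(j + 1) a_j`, combined with
`(k + 1)! ≥ ((k + 1) / e) ^ (k + 1)`. -/
theorem geom_mean_le_weighted_sum (a : ℕ → ℝ) (ha : ∀ k, 0 ≤ a k) (k : ℕ) :
    (∏ j ∈ Finset.range (k + 1), a j) ^ (1 / ((k : ℝ) + 1)) ≤
      Real.exp 1 / ((k : ℝ) + 1) ^ 2 * ∑ j ∈ Finset.range (k + 1), ((j : ℝ) + 1) * a j := by
  have hk : (0 : ℝ) < (k : ℝ) + 1 := by positivity
  have hP : (0 : ℝ) ≤ ∏ j ∈ Finset.range (k + 1), a j := Finset.prod_nonneg fun j _ => ha j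
  have hfac : ∏ j ∈ Finset.range (k + 1), ((j : ℝ) + 1) = ((k + 1).factorial : ℝ) := by
    rw [← Finset.prod_range_add_one_eq_factorial]; push_cast; rfl
  have hamgm := Real.geom_mean_le_arith_mean_weighted (Finset.range (k + 1))
    (fun _ => 1 / ((k : ℝ) + 1)) (fun j => ((j : ℝ) + 1) * a j)
    (fun _ _ => by positivity) (by simp; field_simp) (fun j _ => mul_nonneg (by positivity) (ha j))
  rw [Real.finsetProd_rpow _ _ (fun j _ => mul_nonneg (by positivity) (ha j)),
    Finset.prod_mul_distrib, hfac, ← Finset.mul_sum,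
    Real.mul_rpow (by positivity) hP] at hamgm
  have hst : ((k : ℝ) + 1) / Real.exp 1 ≤ ((k + 1).factorial : ℝ) ^ (1 / ((k : ℝ) + 1)) := by
    have h1 := Real.pow_div_factorial_le_exp (x := (k : ℝ) + 1) hk.le (k + 1)
    have h2 : (((k : ℝ) + 1) / Real.exp 1) ^ (k + 1) ≤ ((k + 1).factorial : ℝ) := by
      rw [div_pow, ← Real.exp_nat_mul, div_le_iff₀ (Real.exp_pos _), mul_comm]
      rw [div_le_iff₀ (by positivity)] at h1
      simpa using h1
    calc ((k : ℝ) + 1) / Real.exp 1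
        = ((((k : ℝ) + 1) / Real.exp 1) ^ (k + 1)) ^ (1 / ((k : ℝ) + 1)) := by
          rw [← Real.rpow_natCast, ← Real.rpow_mul (by positivity)]
          push_cast
          rw [mul_one_div_cancel hk.ne', Real.rpow_one]
      _ ≤ _ := Real.rpow_le_rpow (by positivity) h2 (by positivity)
  have h3 := (mul_le_mul_of_nonneg_right hst (Real.rpow_nonneg hP (1 / ((k : ℝ) + 1)))).trans hamgm
  set Q := (∏ j ∈ Finset.range (k + 1), a j) ^ (1 / ((k : ℝ) + 1))
  set S := ∑ j ∈ Finset.range (k + 1), ((j : ℝ) + 1) * a j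
  have he := Real.exp_pos 1
  calc Q = Real.exp 1 / ((k : ℝ) + 1) * (((k : ℝ) + 1) / Real.exp 1 * Q) := by field_simp
    _ ≤ Real.exp 1 / ((k : ℝ) + 1) * (1 / ((k : ℝ) + 1) * S) := by gcongr
    _ = _ := by field_simp

/-- **Carleman's inequality**, in qualitative form: the geometric means of the initial segments of a
summable nonnegative sequence are summable. -/
theorem summable_geom_mean {a : ℕ → ℝ} (ha : ∀ k, 0 ≤ a k) (hs : Summable a) :
    Summable fun k : ℕ => (∏ j ∈ Finset.range (k + 1), a j) ^ (1 / ((k : ℝ) + 1)) := by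
  -- The weight of `a j` in the double sum below is at most `2 e`, by the tail bound for `∑ 1 / k²`.
  have htel : ∀ K j : ℕ, j ≤ K →
      ∑ k ∈ Finset.Ico j K, 1 / ((k : ℝ) + 1) ^ 2 ≤ 2 / ((j : ℝ) + 1) - 2 / ((K : ℝ) + 1) := by
    intro K j hjK
    induction K, hjK using Nat.le_induction with
    | base => simp
    | succ K hK ih =>
      rw [Finset.sum_Ico_succ_top hK]
      have h1 : 1 / ((K : ℝ) + 1) ^ 2 ≤ 2 * (1 / ((K : ℝ) + 1) - 1 / ((K : ℝ) + 2)) := by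
        have : 2 * (1 / ((K : ℝ) + 1) - 1 / ((K : ℝ) + 2)) =
            2 / (((K : ℝ) + 1) * ((K : ℝ) + 2)) := by field_simp; ring
        rw [this, div_le_div_iff₀ (by positivity) (by positivity)]
        nlinarith [(Nat.cast_nonneg K : (0 : ℝ) ≤ K)]
      have h2 : ((K + 1 : ℕ) : ℝ) + 1 = (K : ℝ) + 2 := by push_cast; ring
      rw [h2]
      ring_nf at h1 ih ⊢
      linarith
  refine summable_of_sum_range_le (c := 2 * Real.exp 1 * ∑' j, a j)
    (fun k => Real.rpow_nonneg (Finset.prod_nonneg fun j _ => ha j) _) fun K => ?_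
  calc _ ≤ ∑ k ∈ Finset.range K, ∑ j ∈ Finset.range (k + 1),
          Real.exp 1 / ((k : ℝ) + 1) ^ 2 * (((j : ℝ) + 1) * a j) := by
        refine Finset.sum_le_sum fun k _ => ?_
        rw [← Finset.mul_sum]
        exact geom_mean_le_weighted_sum a ha k
    _ = ∑ j ∈ Finset.range K, ∑ k ∈ Finset.Ico j K,
          Real.exp 1 / ((k : ℝ) + 1) ^ 2 * (((j : ℝ) + 1) * a j) := by
        refine Finset.sum_comm' fun k j => ?_
        simp only [Finset.mem_range, Finset.mem_Ico]; omega
    _ ≤ ∑ j ∈ Finset.range K, 2 * Real.exp 1 * a j := by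
        refine Finset.sum_le_sum fun j hj => ?_
        have h := htel K j (Finset.mem_range.1 hj).le
        have h' : ∑ k ∈ Finset.Ico j K, 1 / ((k : ℝ) + 1) ^ 2 ≤ 2 / ((j : ℝ) + 1) :=
          h.trans (sub_le_self _ (by positivity))
        calc _ = Real.exp 1 * (((j : ℝ) + 1) * a j) *
              ∑ k ∈ Finset.Ico j K, 1 / ((k : ℝ) + 1) ^ 2 := by
              rw [Finset.mul_sum]
              refine Finset.sum_congr rfl fun k _ => by ring
          _ ≤ Real.exp 1 * (((j : ℝ) + 1) * a j) * (2 / ((j : ℝ) + 1)) := by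
              have := ha j
              gcongr
          _ = _ := by field_simp
    _ ≤ _ := by
        rw [← Finset.mul_sum]
        gcongr
        exact hs.sum_le_tsum _ fun j _ => ha j

/-! ### Bang's propagation argument -/

/-- Bang's propagation estimate. Here `a t j` stands for the size of the `j`-th derivative at time `t`
of a smooth function, `M j` for a global bound on it, and `r j` for a nondecreasing bound on
`M (j + 1) / M j`. If all derivatives vanish at time `0`, then at time `t` they are at most
`exp (j - m) * M j`, as long as `t` does not exceed a partial sum of `∑_{k ≥ m} 1 / (e * r k)`:
during a time `1 / (e * r m)`, the supremum of `exp (-j) * a t j / M j` cannot grow from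
`exp (-(m + 1))` beyond `exp (-m)`. -/
theorem bang_bound {a : ℝ → ℕ → ℝ} {M r : ℕ → ℝ} (hM : ∀ j, 0 ≤ M j) (hr : ∀ j, 0 < r j)
    (hrmono : Monotone r) (hMr : ∀ j, M (j + 1) ≤ M j * r j)
    (haM : ∀ t j, a t j ≤ M j) (ha0 : ∀ j, a 0 j = 0)
    (htaylor : ∀ t h, 0 ≤ h → ∀ j l, a (t + h) j ≤
      (∑ i ∈ Finset.range l, h ^ i / i.factorial * a t (j + i)) +
        h ^ l / l.factorial * M (j + l)) (l : ℕ) :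
    ∀ m : ℕ, ∀ t, 0 ≤ t → t ≤ ∑ k ∈ Finset.range l, 1 / (Real.exp 1 * r (m + k)) →
      ∀ j : ℕ, a t j ≤ Real.exp ((j : ℝ) - m) * M j := by
  have hpow : ∀ m i j : ℕ, j + i ≤ m + 1 → M (j + i) ≤ M j * r m ^ i := by
    intro m i
    induction i with
    | zero => intro j _; simp
    | succ i ih =>
      intro j hj
      calc M (j + i + 1) ≤ M (j + i) * r (j + i) := hMr _
        _ ≤ (M j * r m ^ i) * r m := by
            have := hM j
            have := hr m
            have h1 := ih j (by omega)
            have h2 : r (j + i) ≤ r m := hrmono (by omega)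
            have := (hr (j + i)).le
            gcongr
        _ = _ := by ring
  induction l with
  | zero =>
    intro m t ht0 ht j
    obtain rfl : t = 0 := le_antisymm (by simpa using ht) ht0
    rw [ha0]
    have := hM j
    positivity
  | succ l ih =>
    intro m t ht0 ht j
    have hMj := hM j
    rw [Finset.sum_range_succ'] at ht
    have hcongr : ∑ k ∈ Finset.range l, 1 / (Real.exp 1 * r (m + (k + 1))) =
        ∑ k ∈ Finset.range l, 1 / (Real.exp 1 * r (m + 1 + k)) :=
      Finset.sum_congr rfl fun k _ => by rw [add_right_comm, add_assoc]
    rw [hcongr] at ht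
    set T := ∑ k ∈ Finset.range l, 1 / (Real.exp 1 * r (m + 1 + k))
    have hT0 : 0 ≤ T := Finset.sum_nonneg fun k _ => by have := hr (m + 1 + k); positivity
    by_cases htT : t ≤ T
    · refine (ih (m + 1) t ht0 htT j).trans ?_
      gcongr
      linarith
    -- From order `m + 1` on, the global bound `M j` is good enough.
    by_cases hj : m + 1 ≤ j
    · refine (haM t j).trans (le_mul_of_one_le_left hMj (Real.one_le_exp ?_))
      have : (m : ℝ) + 1 ≤ j := by exact_mod_cast hj
      linarith
    push Not at htT hj
    -- Below order `m + 1`, expand to order `m + 1` around the time `T` already reached.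
    obtain ⟨q, hq⟩ : ∃ q, m + 1 = j + q := ⟨m + 1 - j, by omega⟩
    set h := t - T with hh
    clear_value h
    have hh0 : 0 ≤ h := by linarith
    have hrm := hr m
    have hhr : Real.exp 1 * h * r m ≤ 1 := by
      have : h ≤ 1 / (Real.exp 1 * r m) := by rw [add_zero] at ht; linarith
      rw [le_div_iff₀ (by positivity)] at this
      linarith
    have hT := ih (m + 1) T hT0 le_rfl
    set E := Real.exp ((j : ℝ) - (m + 1 : ℕ))
    have hqE : E * Real.exp 1 ^ q = 1 := by
      rw [← Real.exp_nat_mul, ← Real.exp_add]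
      rw [hq]; push_cast; ring_nf; simp
    calc a t j = a (T + h) j := by rw [hh, add_sub_cancel]
      _ ≤ (∑ i ∈ Finset.range q, h ^ i / i.factorial * a T (j + i)) +
          h ^ q / q.factorial * M (j + q) := htaylor T h hh0 j q
      _ ≤ (∑ i ∈ Finset.range q, E * M j * ((Real.exp 1 * h * r m) ^ i / i.factorial)) +
          E * M j * ((Real.exp 1 * h * r m) ^ q / q.factorial) := by
        refine add_le_add (Finset.sum_le_sum fun i hi => ?_) ?_
        · have hi' := Finset.mem_range.1 hi
          calc h ^ i / i.factorial * a T (j + i)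
              ≤ h ^ i / i.factorial *
                  (Real.exp (((j + i : ℕ) : ℝ) - (m + 1 : ℕ)) * (M j * r m ^ i)) := by
                gcongr
                refine (hT (j + i)).trans ?_
                gcongr
                exact hpow m i j (by omega)
            _ = _ := by
                have : Real.exp (((j + i : ℕ) : ℝ) - (m + 1 : ℕ)) = E * Real.exp 1 ^ i := by
                  rw [← Real.exp_nat_mul, ← Real.exp_add]; push_cast; ring_nf
                rw [this]; ring
        · calc h ^ q / q.factorial * M (j + q) ≤ h ^ q / q.factorial * (M j * r m ^ q) := by
                gcongr
                exact hpow m q j hq.ge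
            _ = h ^ q / q.factorial * (E * Real.exp 1 ^ q * M j * r m ^ q) := by rw [hqE, one_mul]
            _ = _ := by ring
      _ = E * M j * ∑ i ∈ Finset.range (q + 1), (Real.exp 1 * h * r m) ^ i / i.factorial := by
        rw [Finset.sum_range_succ, mul_add, Finset.mul_sum]
      _ ≤ E * M j * Real.exp 1 := by
        gcongr
        exact (Real.sum_le_exp_of_nonneg (by positivity) _).trans (Real.exp_le_exp.2 hhr)
      _ = Real.exp ((j : ℝ) - m) * M j := by
        rw [mul_right_comm, ← Real.exp_add]; push_cast; ring_nf

/-- The Denjoy–Carleman theorem in the form given by Bang's argument, with the sizes of the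
derivatives replaced by numbers `a t j` that satisfy Taylor's inequality: if `∑ 1 / r j` diverges and all
`a 0 j` vanish, then no `a t j` with `t ≥ 0` is positive. -/
theorem bang_vanishing {a : ℝ → ℕ → ℝ} {M r : ℕ → ℝ} (hM : ∀ j, 0 ≤ M j) (hr : ∀ j, 0 < r j)
    (hrmono : Monotone r) (hMr : ∀ j, M (j + 1) ≤ M j * r j)
    (hdiv : ¬ Summable fun j => (r j)⁻¹)
    (haM : ∀ t j, a t j ≤ M j) (ha0 : ∀ j, a 0 j = 0)
    (htaylor : ∀ t h, 0 ≤ h → ∀ j l, a (t + h) j ≤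
      (∑ i ∈ Finset.range l, h ^ i / i.factorial * a t (j + i)) +
        h ^ l / l.factorial * M (j + l)) {t : ℝ} (ht : 0 ≤ t) (j : ℕ) : a t j ≤ 0 := by
  have hbound : ∀ m : ℕ, a t j ≤ Real.exp ((j : ℝ) - m) * M j := by
    intro m
    have hdiv' : ¬ Summable fun k => 1 / (Real.exp 1 * r (m + k)) := by
      intro hs
      refine hdiv ((summable_nat_add_iff m).1 ?_)
      refine (hs.mul_left (Real.exp 1)).congr fun k => ?_
      have := hr (m + k)
      rw [add_comm k]; field_simp
    have hT := (not_summable_iff_tendsto_nat_atTop_of_nonneg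
      (fun k => by have := hr (m + k); positivity)).1 hdiv'
    obtain ⟨l, hl⟩ := (hT.eventually_ge_atTop t).exists
    exact bang_bound hM hr hrmono hMr haM ha0 htaylor l m t ht hl j
  suffices h : Filter.Tendsto (fun m : ℕ => Real.exp ((j : ℝ) - m) * M j) Filter.atTop
      (nhds (0 * M j)) by
    simpa using ge_of_tendsto' h hbound
  refine Filter.Tendsto.mul_const _ (Real.tendsto_exp_atBot.comp ?_)
  exact Filter.tendsto_atBot_add_const_left _ _
    (Filter.tendsto_neg_atTop_atBot.comp tendsto_natCast_atTop_atTop)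

/-! ### Taylor's formula on the imaginary axis -/

/-- The Taylor remainder of `exp` on the imaginary axis. Unlike off the axis, there is no exponential
factor, so that the bound is integrable against `μ` when `z` is a multiple of a coordinate. -/
theorem norm_exp_sub_sum_le_of_re_eq_zero {z : ℂ} (hz : z.re = 0) (n : ℕ) :
    ‖Complex.exp z - ∑ k ∈ Finset.range n, z ^ k / k.factorial‖ ≤ ‖z‖ ^ n / n.factorial := by
  suffices h : ∀ y : ℝ, 0 ≤ y →
      ‖Complex.exp (y * z) - ∑ k ∈ Finset.range n, (y * z) ^ k / k.factorial‖ ≤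
        (y * ‖z‖) ^ n / n.factorial by
    simpa using h 1 zero_le_one
  induction n with
  | zero => intro y _; simp [Complex.norm_exp, hz]
  | succ n ih =>
    intro y hy
    have hd : ∀ x : ℝ, HasDerivAt
        (fun x : ℝ => Complex.exp (x * z) -
          ∑ k ∈ Finset.range (n + 1), ((x : ℂ) * z) ^ k / k.factorial)
        (z * (Complex.exp (x * z) - ∑ k ∈ Finset.range n, ((x : ℂ) * z) ^ k / k.factorial)) x := by
      intro x
      have hx : HasDerivAt (fun x : ℝ => (x : ℂ) * z) z x := by
        simpa using (Complex.ofRealCLM.hasDerivAt (x := x)).mul_const z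
      have hs : HasDerivAt
          (fun x : ℝ => ∑ k ∈ Finset.range (n + 1), ((x : ℂ) * z) ^ k / k.factorial)
          (z * ∑ k ∈ Finset.range n, ((x : ℂ) * z) ^ k / k.factorial) x := by
        have h1 := HasDerivAt.fun_sum (u := Finset.range (n + 1)) fun k _ =>
          (hx.fun_pow k).div_const (k.factorial : ℂ)
        refine h1.congr_deriv ?_
        rw [Finset.sum_range_succ', Finset.mul_sum]
        simp only [Nat.cast_zero, zero_mul, zero_div, add_zero]
        refine Finset.sum_congr rfl fun k _ => ?_
        have : (k.factorial : ℂ) ≠ 0 := by exact_mod_cast k.factorial_ne_zero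
        have : (k : ℂ) + 1 ≠ 0 := by exact_mod_cast k.succ_ne_zero
        rw [Nat.factorial_succ, Nat.add_sub_cancel]
        push_cast
        field_simp
      exact (hx.cexp.sub hs).congr_deriv (by ring)
    have hB : ∀ x : ℝ, HasDerivAt (fun x : ℝ => (x * ‖z‖) ^ (n + 1) / (n + 1).factorial)
        (‖z‖ * ((x * ‖z‖) ^ n / n.factorial)) x := by
      intro x
      have h1 := (((hasDerivAt_id x).mul_const ‖z‖).fun_pow (n + 1)).div_const
        ((n + 1).factorial : ℝ)
      refine h1.congr_deriv ?_
      rw [Nat.factorial_succ, Nat.add_sub_cancel]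
      push_cast
      simp only [id]
      field_simp
    refine image_norm_le_of_norm_deriv_right_le_deriv_boundary (a := 0) (b := y)
      (fun x _ => (hd x).continuousAt.continuousWithinAt)
      (fun x _ => (hd x).hasDerivWithinAt) ?_ (fun x => hB x) ?_ ⟨hy, le_rfl⟩
    · simp [Finset.sum_range_succ']
    · intro x hx
      rw [norm_mul]
      gcongr
      exact ih x hx.1

variable {n : ℕ} {μ : Measure (Fin n → ℝ)}

/-! ### Moments under the Carleman condition -/

theorem ae_eq_zero_of_evenMoment_eq_zero {i : Fin n} {k : ℕ} (h : evenMoment μ i k = 0) :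
    ∀ᵐ x ∂μ, x i = 0 := by
  rw [evenMoment, lintegral_eq_zero_iff (by fun_prop)] at h
  filter_upwards [h] with x hx
  have h1 : x i ^ (2 * k) ≤ 0 := by simpa using hx
  rw [pow_mul] at h1
  by_contra hne
  have : 0 < (x i ^ 2) ^ k := by positivity
  linarith

/-- An infinite moment makes all later moments infinite, hence all but finitely many terms of the
Carleman series zero; a remaining term could then only be infinite if the coordinate vanished almost
everywhere. -/
theorem evenMoment_ne_top [IsFiniteMeasure μ] (hμ : Carleman μ) (i : Fin n) (k : ℕ) :
    evenMoment μ i k ≠ ⊤ := by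
  intro hk
  have hmono : ∀ l, k ≤ l → evenMoment μ i l = ⊤ := by
    intro l hl
    have h1 : evenMoment μ i k ≤ μ Set.univ + evenMoment μ i l := by
      rw [← lintegral_one, evenMoment, evenMoment, ← lintegral_add_left measurable_const]
      refine lintegral_mono fun x => ?_
      rw [← ENNReal.ofReal_one, ← ENNReal.ofReal_add zero_le_one (by rw [pow_mul]; positivity)]
      refine ENNReal.ofReal_le_ofReal ?_
      rw [pow_mul, pow_mul]
      rcases le_total (x i ^ 2) 1 with h | h
      · have := pow_le_one₀ (n := k) (sq_nonneg (x i)) h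
        have : 0 ≤ (x i ^ 2) ^ l := by positivity
        linarith
      · have := pow_le_pow_right₀ h hl
        linarith
    rw [hk, top_le_iff, ENNReal.add_eq_top] at h1
    exact h1.resolve_left (measure_ne_top μ _)
  have htail : ∀ l ∉ Finset.range k,
      evenMoment μ i (l + 1) ^ (-(1 / (2 * ((l : ℝ) + 1)))) = 0 := by
    intro l hl
    rw [hmono (l + 1) (by simp at hl; omega), ENNReal.top_rpow_of_neg]
    have : 0 < 1 / (2 * ((l : ℝ) + 1)) := by positivity
    linarith
  have hsum := hμ i
  rw [tsum_eq_sum htail, ENNReal.sum_eq_top] at hsum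
  obtain ⟨l, -, hl⟩ := hsum
  have hpos : 0 < 1 / (2 * ((l : ℝ) + 1)) := by positivity
  have hzero : evenMoment μ i (l + 1) = 0 := by
    rcases ENNReal.rpow_eq_top_iff.1 hl with h | h
    · exact h.1
    · linarith [h.2]
  have hae := ae_eq_zero_of_evenMoment_eq_zero hzero
  refine hk.not_lt ((?_ : evenMoment μ i k ≤ μ Set.univ).trans_lt (measure_lt_top μ _))
  rw [← lintegral_one]
  refine lintegral_mono_ae ?_
  filter_upwards [hae] with x hx
  rw [hx, ENNReal.ofReal_le_one]
  exact pow_le_one₀ le_rfl zero_le_one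

theorem memLp_coord [IsFiniteMeasure μ] (hμ : Carleman μ) (i : Fin n) {q : ENNReal} (hq : q ≠ ⊤) :
    MemLp (fun x : Fin n → ℝ => x i) q μ := by
  obtain ⟨k, hk⟩ := ENNReal.exists_nat_gt hq
  have hk0 : 0 < k := by
    rcases Nat.eq_zero_or_pos k with rfl | h
    · simp at hk
    · exact h
  have h2 : MemLp (fun x : Fin n → ℝ => x i) (2 * k : ℕ) μ := by
    refine ⟨(measurable_pi_apply i).aestronglyMeasurable, ?_⟩
    rw [eLpNorm_lt_top_iff_lintegral_rpow_enorm_lt_top (by simp; omega) (ENNReal.natCast_ne_top _)]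
    convert! (evenMoment_ne_top hμ i k).lt_top using 3 with x
    rw [evenMoment]
    congr! 2 with x
    rw [ENNReal.toReal_natCast, ENNReal.rpow_natCast, ← enorm_pow, Real.enorm_of_nonneg]
    rw [pow_mul]; positivity
  refine h2.mono_exponent (hk.le.trans ?_)
  exact_mod_cast (by omega : k ≤ 2 * k)

theorem holderTriple_mul_two (q : ENNReal) : ENNReal.HolderTriple (q * 2) (q * 2) q :=
  ⟨by rw [ENNReal.mul_inv (by simp) (by simp), ← mul_add, ENNReal.inv_two_add_inv_two, mul_one]⟩

/-- On every box `|y i| ≤ |x i|`, a polynomial is bounded by a function of the corner `x` all of whose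
moments are finite. -/
theorem exists_monotone_bound [IsFiniteMeasure μ] (hμ : Carleman μ)
    (p : MvPolynomial (Fin n) ℝ) :
    ∃ G : (Fin n → ℝ) → ℝ, (∀ q : ENNReal, q ≠ ⊤ → MemLp G q μ) ∧
      ∀ x y : Fin n → ℝ, (∀ i, |y i| ≤ |x i|) → |MvPolynomial.eval y p| ≤ G x := by
  induction p using MvPolynomial.induction_on with
  | C a => exact ⟨fun _ => |a|, fun q _ => memLp_const _, fun x y _ => by simp⟩
  | add p₁ p₂ h₁ h₂ =>
    obtain ⟨G₁, hG₁, h₁⟩ := h₁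
    obtain ⟨G₂, hG₂, h₂⟩ := h₂
    refine ⟨fun x => G₁ x + G₂ x, fun q hq => (hG₁ q hq).add (hG₂ q hq), fun x y hxy => ?_⟩
    rw [map_add]
    exact (abs_add_le _ _).trans (add_le_add (h₁ x y hxy) (h₂ x y hxy))
  | mul_X p i h =>
    obtain ⟨G, hG, h⟩ := h
    refine ⟨fun x => G x * |x i|, fun q hq => ?_, fun x y hxy => ?_⟩
    · have h2 : q * 2 ≠ ⊤ := ENNReal.mul_ne_top hq (by simp)
      have := holderTriple_mul_two q
      exact (memLp_coord hμ i h2).abs.mul' (hG _ h2)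
    · rw [map_mul, MvPolynomial.eval_X, abs_mul]
      exact mul_le_mul (h x y hxy) (hxy i) (abs_nonneg _) ((abs_nonneg _).trans (h x y hxy))

theorem continuous_eval (p : MvPolynomial (Fin n) ℝ) :
    Continuous fun x : Fin n → ℝ => MvPolynomial.eval x p :=
  MvPolynomial.continuous_eval p

theorem memLp_eval [IsFiniteMeasure μ] (hμ : Carleman μ) (p : MvPolynomial (Fin n) ℝ)
    {q : ENNReal} (hq : q ≠ ⊤) : MemLp (fun x => MvPolynomial.eval x p) q μ := by
  obtain ⟨G, hG, h⟩ := exists_monotone_bound hμ p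
  refine (hG q hq).mono' (continuous_eval p).aestronglyMeasurable (.of_forall fun x => ?_)
  exact h x x fun _ => le_rfl

theorem integrable_coord_pow [IsFiniteMeasure μ] (hμ : Carleman μ) (i : Fin n) (k : ℕ) :
    Integrable (fun x : Fin n → ℝ => x i ^ k) μ := by
  have := memLp_eval hμ (MvPolynomial.X i ^ k) (q := 1) (by simp)
  simpa [memLp_one_iff_integrable] using this

/-- The real-valued even moment `∫ x_i^{2k} dμ`. -/
noncomputable def realMoment (μ : Measure (Fin n → ℝ)) (i : Fin n) (k : ℕ) : ℝ :=
  ∫ x, x i ^ (2 * k) ∂μ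

theorem coord_pow_even_nonneg (x : Fin n → ℝ) (i : Fin n) (k : ℕ) : 0 ≤ x i ^ (2 * k) := by
  rw [pow_mul]; positivity

theorem evenMoment_eq_ofReal [IsFiniteMeasure μ] (hμ : Carleman μ) (i : Fin n) (k : ℕ) :
    evenMoment μ i k = ENNReal.ofReal (realMoment μ i k) :=
  (ofReal_integral_eq_lintegral_ofReal (integrable_coord_pow hμ i _)
    (.of_forall fun x => coord_pow_even_nonneg x i k)).symm

theorem realMoment_pos [IsFiniteMeasure μ] (hμ : Carleman μ) {i : Fin n}
    (hi : ¬ ∀ᵐ x ∂μ, x i = 0) (k : ℕ) : 0 < realMoment μ i k := by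
  by_contra hle
  refine hi (ae_eq_zero_of_evenMoment_eq_zero (k := k) ?_)
  rw [evenMoment_eq_ofReal hμ, ENNReal.ofReal_eq_zero]
  exact not_lt.1 hle

/-- Log-convexity of the moments, from the sign of the quadratic polynomial
`c ↦ ∫ x_i^{2k} (x_i² - c)² dμ`. -/
theorem realMoment_sq_le [IsFiniteMeasure μ] (hμ : Carleman μ) (i : Fin n) (k : ℕ) :
    realMoment μ i (k + 1) ^ 2 ≤ realMoment μ i k * realMoment μ i (k + 2) := by
  have hquad : ∀ c : ℝ, 0 ≤ realMoment μ i k * (c * c) +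
      (-2 * realMoment μ i (k + 1)) * c + realMoment μ i (k + 2) := by
    intro c
    have hk := fun l => integrable_coord_pow hμ i l
    have : realMoment μ i k * (c * c) + (-2 * realMoment μ i (k + 1)) * c +
        realMoment μ i (k + 2) = ∫ x, x i ^ (2 * k) * (x i ^ 2 - c) ^ 2 ∂μ := by
      have hexp : ∀ x : Fin n → ℝ, x i ^ (2 * k) * (x i ^ 2 - c) ^ 2 =
          x i ^ (2 * k) * (c * c) + x i ^ (2 * (k + 1)) * (-2 * c) + x i ^ (2 * (k + 2)) := by
        intro x; ring
      simp_rw [hexp]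
      have hadd := ((hk (2 * k)).mul_const (c * c)).add ((hk (2 * (k + 1))).mul_const (-2 * c))
      rw [integral_add (by exact hadd) (hk _), integral_add ((hk _).mul_const _) ((hk _).mul_const _), integral_mul_const,
        integral_mul_const]
      unfold realMoment
      ring
    rw [this]
    exact integral_nonneg fun x => mul_nonneg (coord_pow_even_nonneg x i k) (sq_nonneg _)
  have := discrim_le_zero hquad
  rw [discrim] at this
  linarith

theorem monotone_momentRatio [IsFiniteMeasure μ] (hμ : Carleman μ) {i : Fin n}
    (hi : ¬ ∀ᵐ x ∂μ, x i = 0) :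
    Monotone fun k => realMoment μ i (k + 1) / realMoment μ i k := by
  refine monotone_nat_of_le_succ fun k => ?_
  have hpos := realMoment_pos hμ hi
  rw [div_le_div_iff₀ (hpos _) (hpos _)]
  have := realMoment_sq_le hμ i k
  linarith

/-- The Carleman condition in terms of moment ratios. The terms of the Carleman series are, up to
bounded factors, the geometric means of the inverse square roots of these ratios, so Carleman's
inequality applies. -/
theorem not_summable_momentRatio [IsFiniteMeasure μ] (hμ : Carleman μ) {i : Fin n}
    (hi : ¬ ∀ᵐ x ∂μ, x i = 0) :
    ¬ Summable fun k => (√(realMoment μ i (k + 1) / realMoment μ i k))⁻¹ := by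
  intro hs
  have hpos := realMoment_pos hμ hi
  set Y := realMoment μ i with hY
  have hprod : ∀ k, ∏ j ∈ Finset.range k, (√(Y (j + 1) / Y j))⁻¹ = √(Y 0 / Y k) := by
    intro k
    induction k with
    | zero => simp [(hpos 0).ne']
    | succ k ih =>
      have h0 := hpos 0
      have h1 := hpos k
      have h2 := hpos (k + 1)
      rw [Finset.prod_range_succ, ih, ← Real.sqrt_inv, ← Real.sqrt_mul (by positivity)]
      congr 1
      field_simp
  have hgeom := summable_geom_mean (fun k => by positivity) hs
  simp_rw [hprod] at hgeom
  have hY0 := hpos 0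
  -- The factors `Y 0 ^ (1 / (2 (k + 1)))` are bounded below by `min 1 (Y 0)`.
  have hmin : 0 < min 1 (Y 0) := lt_min one_pos hY0
  have hterm : Summable fun k : ℕ => Y (k + 1) ^ (-(1 / (2 * ((k : ℝ) + 1)))) := by
    refine (hgeom.mul_left (min 1 (Y 0))⁻¹).of_nonneg_of_le
      (fun k => Real.rpow_nonneg (hpos _).le _) fun k => ?_
    rw [Real.sqrt_eq_rpow, ← Real.rpow_mul (by have := hpos (k + 1); positivity),
      Real.div_rpow hY0.le (hpos _).le, Real.rpow_neg (hpos _).le]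
    have hexp : (1 : ℝ) / 2 * (1 / ((k : ℝ) + 1)) = 1 / (2 * ((k : ℝ) + 1)) := by field_simp
    rw [hexp, div_eq_mul_inv (Y 0 ^ _), ← mul_assoc]
    refine le_mul_of_one_le_left (by have := hpos (k + 1); positivity) ?_
    rw [inv_mul_eq_div, one_le_div hmin]
    have hle : 1 / (2 * ((k : ℝ) + 1)) ≤ 1 := by
      rw [div_le_one (by positivity)]
      linarith [(Nat.cast_nonneg k : (0 : ℝ) ≤ k)]
    calc min 1 (Y 0) = min 1 (Y 0) ^ (1 : ℝ) := (Real.rpow_one _).symm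
      _ ≤ min 1 (Y 0) ^ (1 / (2 * ((k : ℝ) + 1))) :=
        Real.rpow_le_rpow_of_exponent_ge hmin (min_le_left _ _) hle
      _ ≤ _ := Real.rpow_le_rpow hmin.le (min_le_right _ _) (by positivity)
  refine hterm.tsum_ofReal_ne_top ?_
  rw [← hμ i]
  refine tsum_congr fun k => ?_
  rw [evenMoment_eq_ofReal hμ, ENNReal.ofReal_rpow_of_pos (hpos _)]

theorem eLpNorm_coord_pow_eight [IsFiniteMeasure μ] (hμ : Carleman μ) (i : Fin n) (k : ℕ) :
    eLpNorm (fun x : Fin n → ℝ => x i ^ k) 8 μ =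
      ENNReal.ofReal (realMoment μ i (4 * k) ^ (1 / 8 : ℝ)) := by
  rw [eLpNorm_eq_lintegral_rpow_enorm_toReal (by simp) (by simp), realMoment,
    ← ENNReal.ofReal_rpow_of_nonneg (integral_nonneg fun x => coord_pow_even_nonneg x i _)
      (by positivity), ← realMoment, ← evenMoment_eq_ofReal hμ, evenMoment]
  simp only [ENNReal.toReal_ofNat]
  congr! 3 with x
  rw [show (8 : ℝ) = (8 : ℕ) by norm_num, ENNReal.rpow_natCast, ← enorm_pow, ← pow_mul,
    Real.enorm_of_nonneg]
  · congr 2; ring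
  · rw [show k * 8 = 2 * (4 * k) by ring]
    exact coord_pow_even_nonneg x i _

/-- The `L⁸(μ)` norms of the powers of `x_i` satisfy the hypotheses of `bang_vanishing`. The ratio
bound `r j` is the square root of the moment ratio of index `4 j + 3`; as the moment ratios are
monotone, restricting them to one residue class modulo `4` does not affect the divergence. -/
theorem exists_ratio_bound [IsFiniteMeasure μ] (hμ : Carleman μ) {i : Fin n}
    (hi : ¬ ∀ᵐ x ∂μ, x i = 0) :
    ∃ r : ℕ → ℝ, (∀ j, 0 < r j) ∧ Monotone r ∧ (¬ Summable fun j => (r j)⁻¹) ∧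
      ∀ j, realMoment μ i (4 * (j + 1)) ^ (1 / 8 : ℝ) ≤
        realMoment μ i (4 * j) ^ (1 / 8 : ℝ) * r j := by
  have hpos := realMoment_pos hμ hi
  have hmono := monotone_momentRatio hμ hi
  have hdiv := not_summable_momentRatio hμ hi
  set Y := realMoment μ i with hY
  set ρ : ℕ → ℝ := fun k => Y (k + 1) / Y k with hρ
  have hρpos : ∀ k, 0 < ρ k := fun k => div_pos (hpos _) (hpos _)
  have hYρ : ∀ k, Y (k + 1) = Y k * ρ k := fun k => by
    have := hpos k
    rw [hρ]; field_simp
  refine ⟨fun j => √(ρ (4 * j + 3)), fun j => Real.sqrt_pos.2 (hρpos _), fun j l hjl =>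
    Real.sqrt_le_sqrt (hmono (by omega)), ?_, fun j => ?_⟩
  · have hanti : Antitone fun k => (√(ρ k))⁻¹ := fun k l hkl =>
      inv_anti₀ (Real.sqrt_pos.2 (hρpos _)) (Real.sqrt_le_sqrt (hmono hkl))
    rwa [← summable_indicator_mod_iff hanti ((3 : ℕ) : ZMod 4),
      summable_indicator_mod_iff_summable] at hdiv
  · have h4 : Y (4 * (j + 1)) ≤ Y (4 * j) * ρ (4 * j + 3) ^ 4 := by
      rw [show 4 * (j + 1) = 4 * j + 1 + 1 + 1 + 1 by ring, hYρ, hYρ, hYρ, hYρ]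
      have h0 : ρ (4 * j) ≤ ρ (4 * j + 3) := hmono (by omega)
      have h1 : ρ (4 * j + 1) ≤ ρ (4 * j + 3) := hmono (by omega)
      have h2 : ρ (4 * j + 2) ≤ ρ (4 * j + 3) := hmono (by omega)
      have p := hpos (4 * j)
      have p0 := hρpos (4 * j)
      have p1 := hρpos (4 * j + 1)
      have p2 := hρpos (4 * j + 2)
      have p3 := hρpos (4 * j + 3)
      calc Y (4 * j) * ρ (4 * j) * ρ (4 * j + 1) * ρ (4 * j + 2) * ρ (4 * j + 3)
          ≤ Y (4 * j) * ρ (4 * j + 3) * ρ (4 * j + 3) * ρ (4 * j + 3) * ρ (4 * j + 3) := by gcongr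
        _ = _ := by ring
    have p3 := hρpos (4 * j + 3)
    calc Y (4 * (j + 1)) ^ (1 / 8 : ℝ) ≤ (Y (4 * j) * ρ (4 * j + 3) ^ 4) ^ (1 / 8 : ℝ) :=
          Real.rpow_le_rpow (hpos _).le h4 (by norm_num)
      _ = _ := by
          rw [Real.mul_rpow (hpos _).le (by positivity), ← Real.rpow_natCast,
            ← Real.rpow_mul p3.le]
          norm_num [Real.sqrt_eq_rpow]

/-! ### Distance to the polynomials in `L⁴` -/

/-- The complex polynomial `A + i B` with real and imaginary parts `A` and `B`, as a function
on `ℝⁿ`. -/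
noncomputable def complexEval (A B : MvPolynomial (Fin n) ℝ) (x : Fin n → ℝ) : ℂ :=
  (MvPolynomial.eval x A : ℂ) + (MvPolynomial.eval x B : ℂ) * Complex.I

theorem continuous_complexEval (A B : MvPolynomial (Fin n) ℝ) : Continuous (complexEval A B) := by
  have hA := continuous_eval A
  have hB := continuous_eval B
  unfold complexEval
  fun_prop

/-- The distance, in the `L⁴(μ)` seminorm, of a complex function to the complex polynomials. -/
noncomputable def polyDist (μ : Measure (Fin n → ℝ)) (f : (Fin n → ℝ) → ℂ) : ENNReal :=
  ⨅ (A : MvPolynomial (Fin n) ℝ) (B : MvPolynomial (Fin n) ℝ),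
    eLpNorm (fun x => f x - complexEval A B x) 4 μ

theorem polyDist_le (f : (Fin n → ℝ) → ℂ) (A B : MvPolynomial (Fin n) ℝ) :
    polyDist μ f ≤ eLpNorm (fun x => f x - complexEval A B x) 4 μ :=
  iInf₂_le (f := fun A B => eLpNorm (fun x => f x - complexEval A B x) 4 μ) A B

theorem exists_eLpNorm_sub_lt {f : (Fin n → ℝ) → ℂ} {c : ENNReal} (h : polyDist μ f < c) :
    ∃ A B : MvPolynomial (Fin n) ℝ, eLpNorm (fun x => f x - complexEval A B x) 4 μ < c := by
  simpa only [polyDist, iInf_lt_iff] using h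

theorem polyDist_le_eLpNorm (f : (Fin n → ℝ) → ℂ) : polyDist μ f ≤ eLpNorm f 4 μ := by
  simpa [complexEval] using polyDist_le (μ := μ) f 0 0

theorem polyDist_eval (p : MvPolynomial (Fin n) ℝ) :
    polyDist μ (fun x => (MvPolynomial.eval x p : ℂ)) = 0 := by
  simpa [complexEval] using polyDist_le (μ := μ) (fun x => (MvPolynomial.eval x p : ℂ)) p 0

theorem polyDist_add_le {f g : (Fin n → ℝ) → ℂ} (hf : Continuous f) (hg : Continuous g) :
    polyDist μ (fun x => f x + g x) ≤ polyDist μ f + polyDist μ g := by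
  refine ENNReal.le_of_forall_pos_le_add fun ε hε hfin => ?_
  have hε2 : (ε / 2 : ENNReal) ≠ 0 := by simp [hε.ne']
  obtain ⟨A, B, h₁⟩ := exists_eLpNorm_sub_lt
    (ENNReal.lt_add_right (lt_of_le_of_lt le_self_add hfin).ne hε2)
  obtain ⟨A', B', h₂⟩ := exists_eLpNorm_sub_lt
    (ENNReal.lt_add_right (lt_of_le_of_lt le_add_self hfin).ne hε2)
  calc polyDist μ (fun x => f x + g x)
      ≤ eLpNorm (fun x => f x + g x - complexEval (A + A') (B + B') x) 4 μ := polyDist_le _ _ _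
    _ = eLpNorm ((fun x => f x - complexEval A B x) + fun x => g x - complexEval A' B' x) 4 μ := by
        congr 1
        ext x
        simp only [complexEval, map_add, Pi.add_apply]
        push_cast
        ring
    _ ≤ _ := eLpNorm_add_le (hf.sub (continuous_complexEval A B)).aestronglyMeasurable
        (hg.sub (continuous_complexEval A' B')).aestronglyMeasurable (by norm_num)
    _ ≤ (polyDist μ f + ε / 2) + (polyDist μ g + ε / 2) := add_le_add h₁.le h₂.le
    _ = polyDist μ f + polyDist μ g + ε := by
        rw [add_add_add_comm, ENNReal.add_halves]

theorem polyDist_const_mul_le (c : ℂ) (f : (Fin n → ℝ) → ℂ) :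
    polyDist μ (fun x => c * f x) ≤ ‖c‖ₑ * polyDist μ f := by
  rcases eq_or_ne c 0 with rfl | hc
  · simpa using (polyDist_eval (μ := μ) (0 : MvPolynomial (Fin n) ℝ)).le
  rw [polyDist.eq_def μ f]
  simp_rw [ENNReal.mul_iInf_of_ne (enorm_ne_zero.2 hc) enorm_ne_top]
  refine le_iInf₂ fun A B => ?_
  refine (polyDist_le _ (MvPolynomial.C c.re * A - MvPolynomial.C c.im * B)
    (MvPolynomial.C c.re * B + MvPolynomial.C c.im * A)).trans_eq ?_
  rw [← eLpNorm_const_smul]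
  congr 1
  ext x
  simp only [complexEval, map_add, map_sub, map_mul, MvPolynomial.eval_C, Pi.smul_apply,
    smul_eq_mul]
  apply Complex.ext <;> simp <;> ring

theorem polyDist_sum_le (l : ℕ) {f : ℕ → (Fin n → ℝ) → ℂ} (hf : ∀ i, Continuous (f i)) :
    polyDist μ (fun x => ∑ i ∈ Finset.range l, f i x) ≤
      ∑ i ∈ Finset.range l, polyDist μ (f i) := by
  induction l with
  | zero => simpa using polyDist_eval (μ := μ) (0 : MvPolynomial (Fin n) ℝ)
  | succ l ih =>
    simp_rw [Finset.sum_range_succ]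
    refine (polyDist_add_le (continuous_finsetSum _ fun i _ => hf i) (hf l)).trans ?_
    gcongr

theorem polyDist_congr_ae {f g : (Fin n → ℝ) → ℂ} (h : f =ᵐ[μ] g) :
    polyDist μ f = polyDist μ g := by
  unfold polyDist
  congr! 4 with A B
  refine eLpNorm_congr_ae ?_
  filter_upwards [h] with x hx
  rw [hx]

/-! ### Tame functions -/

/-- A bounded continuous function all of whose polynomial multiples are `L⁴(μ)`-limits of
polynomials. -/
structure IsTame (μ : Measure (Fin n → ℝ)) (h : (Fin n → ℝ) → ℂ) : Prop where
  continuous : Continuous h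
  bounded : ∃ C : ℝ, ∀ x, ‖h x‖ ≤ C
  polyDist_mul : ∀ p : MvPolynomial (Fin n) ℝ,
    polyDist μ (fun x => (MvPolynomial.eval x p : ℂ) * h x) = 0

theorem continuous_eval_ofReal (p : MvPolynomial (Fin n) ℝ) :
    Continuous fun x : Fin n → ℝ => (MvPolynomial.eval x p : ℂ) :=
  Complex.continuous_ofReal.comp (continuous_eval p)

theorem isTame_one : IsTame μ fun _ => 1 where
  continuous := continuous_const
  bounded := ⟨1, by simp⟩
  polyDist_mul p := by simpa using polyDist_eval p

theorem IsTame.add {h₁ h₂ : (Fin n → ℝ) → ℂ} (t₁ : IsTame μ h₁) (t₂ : IsTame μ h₂) :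
    IsTame μ fun x => h₁ x + h₂ x where
  continuous := t₁.continuous.add t₂.continuous
  bounded := by
    obtain ⟨C₁, b₁⟩ := t₁.bounded
    obtain ⟨C₂, b₂⟩ := t₂.bounded
    exact ⟨C₁ + C₂, fun x => (norm_add_le _ _).trans (add_le_add (b₁ x) (b₂ x))⟩
  polyDist_mul p := by
    simp_rw [mul_add]
    have := polyDist_add_le (μ := μ) ((continuous_eval_ofReal p).fun_mul t₁.continuous)
      ((continuous_eval_ofReal p).fun_mul t₂.continuous)
    rwa [t₁.polyDist_mul, t₂.polyDist_mul, add_zero, nonpos_iff_eq_zero] at this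

theorem IsTame.const_mul {h : (Fin n → ℝ) → ℂ} (t : IsTame μ h) (c : ℂ) :
    IsTame μ fun x => c * h x where
  continuous := continuous_const.mul t.continuous
  bounded := by
    obtain ⟨C, b⟩ := t.bounded
    refine ⟨‖c‖ * C, fun x => ?_⟩
    rw [norm_mul]
    exact mul_le_mul_of_nonneg_left (b x) (norm_nonneg c)
  polyDist_mul p := by
    have := polyDist_const_mul_le (μ := μ) c fun x => (MvPolynomial.eval x p : ℂ) * h x
    rw [t.polyDist_mul, mul_zero, nonpos_iff_eq_zero] at this
    simpa only [mul_left_comm] using this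

theorem IsTame.memLp_mul [IsFiniteMeasure μ] (hμ : Carleman μ) {h : (Fin n → ℝ) → ℂ}
    (t : IsTame μ h) (p : MvPolynomial (Fin n) ℝ) {q : ENNReal} (hq : q ≠ ⊤) :
    MemLp (fun x : Fin n → ℝ => (MvPolynomial.eval x p : ℂ) * h x) q μ := by
  obtain ⟨C, b⟩ := t.bounded
  refine (memLp_eval hμ p hq).of_le_mul (c := C)
    ((continuous_eval_ofReal p).mul t.continuous).aestronglyMeasurable (.of_forall fun x => ?_)
  rw [norm_mul, mul_comm, Complex.norm_real]
  exact mul_le_mul_of_nonneg_right (b x) (norm_nonneg _)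

/-- Hölder's inequality `‖x_i^k g‖₄ ≤ ‖x_i^k‖₈ ‖g‖₈`, applied to a function dominated by
`c |x_i|^k |g|`. -/
theorem eLpNorm_four_le_of_norm_le [IsFiniteMeasure μ] (hμ : Carleman μ) (i : Fin n) (k : ℕ)
    {F g : (Fin n → ℝ) → ℂ} (hg : MemLp g 8 μ) {c : ℝ} (hc : 0 ≤ c)
    (hF : ∀ x, ‖F x‖ ≤ c * (|x i| ^ k * ‖g x‖)) :
    eLpNorm F 4 μ ≤ ENNReal.ofReal
      (c * ((eLpNorm g 8 μ).toReal * realMoment μ i (4 * k) ^ (1 / 8 : ℝ))) := by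
  have hhold : ENNReal.HolderTriple 8 8 4 := by
    have := holderTriple_mul_two 4
    norm_num at this
    exact this
  have hmul : eLpNorm ((fun x : Fin n → ℝ => x i ^ k) • g) 4 μ ≤
      eLpNorm (fun x : Fin n → ℝ => x i ^ k) 8 μ * eLpNorm g 8 μ :=
    eLpNorm_smul_le_mul_eLpNorm hg.1
      ((continuous_apply i).pow k).aestronglyMeasurable
  calc eLpNorm F 4 μ
      ≤ ENNReal.ofReal c * eLpNorm ((fun x : Fin n → ℝ => x i ^ k) • g) 4 μ := by
        refine eLpNorm_le_mul_eLpNorm_of_ae_le_mul (.of_forall fun x => ?_) 4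
        simpa [norm_smul] using hF x
    _ ≤ ENNReal.ofReal c * (eLpNorm (fun x : Fin n → ℝ => x i ^ k) 8 μ * eLpNorm g 8 μ) := by
        gcongr
    _ = _ := by
        have h0 : 0 ≤ realMoment μ i (4 * k) ^ (1 / 8 : ℝ) :=
          Real.rpow_nonneg (integral_nonneg fun x => coord_pow_even_nonneg x i _) _
        rw [eLpNorm_coord_pow_eight hμ, ENNReal.ofReal_mul hc,
          ENNReal.ofReal_mul ENNReal.toReal_nonneg, ENNReal.ofReal_toReal hg.2.ne,
          mul_comm (eLpNorm g 8 μ)]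

/-- Multiplication by a character in one coordinate preserves tameness. For a polynomial `p`, the
distances of `x_i^j p exp(s w x_i) h` to the polynomials play the role of the sizes of the
derivatives, in `s`, of a function with all derivatives zero at `s = 0`; so `bang_vanishing` applies.
The hypothesis `‖w‖ = 1` costs nothing, since `s` is arbitrary, and `w = ± I` covers both
directions. -/
theorem IsTame.mul_exp [IsFiniteMeasure μ] (hμ : Carleman μ) {h : (Fin n → ℝ) → ℂ}
    (t : IsTame μ h) (i : Fin n) {w : ℂ} (hw : w.re = 0) (hw1 : ‖w‖ = 1) {s : ℝ} (hs : 0 ≤ s) :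
    IsTame μ fun x => Complex.exp (s * (x i * w)) * h x := by
  have hcont : Continuous fun x : Fin n → ℝ => (x i : ℂ) :=
    Complex.continuous_ofReal.comp (continuous_apply i)
  have hre : ∀ (u : ℝ) (x : Fin n → ℝ), ((u : ℂ) * (x i * w)).re = 0 := by
    intro u x
    simp [hw]
  have hnorm : ∀ (u : ℝ) (x : Fin n → ℝ), ‖Complex.exp (u * (x i * w))‖ = 1 := by
    intro u x
    rw [Complex.norm_exp, hre, Real.exp_zero]
  have hth := t.continuous
  refine ⟨by fun_prop, ?_, fun p => ?_⟩
  · obtain ⟨C, b⟩ := t.bounded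
    refine ⟨C, fun x => ?_⟩
    rw [norm_mul, hnorm, one_mul]
    exact b x
  -- If the coordinate vanishes almost everywhere, its moment ratios make no sense, but then the
  -- exponential factor is `1` almost everywhere.
  by_cases hi : ∀ᵐ x ∂μ, x i = 0
  · rw [← t.polyDist_mul p]
    refine polyDist_congr_ae ?_
    filter_upwards [hi] with x hx
    simp [hx]
  obtain ⟨r, hr, hrmono, hdiv, hMr⟩ := exists_ratio_bound hμ hi
  have hp := continuous_eval_ofReal p
  set g : (Fin n → ℝ) → ℂ := fun x => (MvPolynomial.eval x p : ℂ) * h x with hgdef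
  have hgc : Continuous g := hp.mul hth
  have hg : MemLp g 8 μ := t.memLp_mul hμ p (by simp)
  set C := (eLpNorm g 8 μ).toReal
  have hC : 0 ≤ C := ENNReal.toReal_nonneg
  set N : ℕ → ℝ := fun j => realMoment μ i (4 * j) ^ (1 / 8 : ℝ)
  have hN : ∀ j, 0 ≤ N j := fun j =>
    Real.rpow_nonneg (integral_nonneg fun x => coord_pow_even_nonneg x i _) _
  set F : ℝ → ℕ → (Fin n → ℝ) → ℂ := fun u j x =>
    (x i : ℂ) ^ j * (Complex.exp (u * (x i * w)) * g x) with hFdef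
  have hFc : ∀ u j, Continuous (F u j) := fun u j => by fun_prop
  have hFN : ∀ u j, polyDist μ (F u j) ≤ ENNReal.ofReal (C * N j) := by
    intro u j
    refine (polyDist_le_eLpNorm _).trans ?_
    have := eLpNorm_four_le_of_norm_le hμ i j hg zero_le_one (F := F u j) fun x => by
      rw [one_mul, hFdef, norm_mul, norm_mul, hnorm, one_mul, norm_pow, Complex.norm_real,
        Real.norm_eq_abs]
    rwa [one_mul] at this
  have hFfin : ∀ u j, polyDist μ (F u j) ≠ ⊤ := fun u j =>
    ((hFN u j).trans_lt ENNReal.ofReal_lt_top).ne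
  have hvanish := bang_vanishing (a := fun u j => (polyDist μ (F u j)).toReal)
    (M := fun j => C * N j) (fun j => mul_nonneg hC (hN j)) hr hrmono
    (fun j => by rw [mul_assoc]; exact mul_le_mul_of_nonneg_left (hMr j) hC) hdiv
    (fun u j => ENNReal.toReal_le_of_le_ofReal (mul_nonneg hC (hN j)) (hFN u j))
    (fun j => ?_) (fun u v hv j l => ?_) hs 0
  · have h0 := (ENNReal.toReal_eq_zero_iff _).1 (le_antisymm hvanish ENNReal.toReal_nonneg)
    rw [← h0.resolve_right (hFfin s 0)]
    congr 1
    ext x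
    simp only [hFdef, hgdef]
    ring
  · have := t.polyDist_mul (MvPolynomial.X i ^ j * p)
    rw [ENNReal.toReal_eq_zero_iff]
    left
    rw [← this]
    congr 1
    ext x
    simp [hFdef, hgdef, mul_assoc]
  · set R : (Fin n → ℝ) → ℂ := fun x => F u j x * (Complex.exp (v * (x i * w)) -
      ∑ k ∈ Finset.range l, (v * (x i * w)) ^ k / k.factorial) with hRdef
    have hRc : Continuous R := by fun_prop
    have hsplit : F (u + v) j = fun x =>
        (∑ k ∈ Finset.range l, ((v * w) ^ k / k.factorial) * F u (j + k) x) + R x := by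
      ext x
      have h1 : ∑ k ∈ Finset.range l, ((v * w) ^ k / k.factorial) * F u (j + k) x =
          F u j x * ∑ k ∈ Finset.range l, (v * (x i * w)) ^ k / k.factorial := by
        rw [Finset.mul_sum]
        refine Finset.sum_congr rfl fun k _ => ?_
        simp only [hFdef]
        ring
      rw [h1, hRdef]
      simp only [hFdef]
      push_cast
      rw [add_mul, Complex.exp_add]
      ring
    have hR : polyDist μ R ≤ ENNReal.ofReal (v ^ l / l.factorial * (C * N (j + l))) := by
      refine (polyDist_le_eLpNorm _).trans
        (eLpNorm_four_le_of_norm_le hμ i (j + l) hg (by positivity) fun x => ?_)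
      have h1 := norm_exp_sub_sum_le_of_re_eq_zero (hre v x) l
      have h2 : ‖(v : ℂ) * (x i * w)‖ = v * |x i| := by
        rw [norm_mul, norm_mul, hw1, mul_one, Complex.norm_real, Complex.norm_real,
          Real.norm_of_nonneg hv, Real.norm_eq_abs]
      rw [h2] at h1
      have h3 : ‖F u j x‖ = |x i| ^ j * ‖g x‖ := by
        rw [hFdef, norm_mul, norm_mul, hnorm, one_mul, norm_pow, Complex.norm_real,
          Real.norm_eq_abs]
      rw [hRdef, norm_mul, h3]
      calc _ ≤ |x i| ^ j * ‖g x‖ * ((v * |x i|) ^ l / l.factorial) := by gcongr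
        _ = _ := by ring
    have hmain : polyDist μ (F (u + v) j) ≤
        (∑ k ∈ Finset.range l, ENNReal.ofReal (v ^ k / k.factorial) * polyDist μ (F u (j + k))) +
          ENNReal.ofReal (v ^ l / l.factorial * (C * N (j + l))) := by
      rw [hsplit]
      refine (polyDist_add_le (continuous_finsetSum _ fun k _ =>
        continuous_const.mul (hFc u (j + k))) hRc).trans (add_le_add ?_ hR)
      refine (polyDist_sum_le l fun k => continuous_const.mul (hFc u (j + k))).trans
        (Finset.sum_le_sum fun k _ => ?_)
      refine (polyDist_const_mul_le _ _).trans_eq ?_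
      congr 1
      rw [← ofReal_norm, norm_div, norm_pow, norm_mul, hw1, mul_one, Complex.norm_real,
        Real.norm_of_nonneg hv, Complex.norm_natCast]
    have hfin : ∀ k ∈ Finset.range l,
        ENNReal.ofReal (v ^ k / k.factorial) * polyDist μ (F u (j + k)) ≠ ⊤ := fun k _ =>
      ENNReal.mul_ne_top ENNReal.ofReal_ne_top (hFfin _ _)
    refine (ENNReal.toReal_mono (ENNReal.add_ne_top.2
      ⟨ENNReal.sum_ne_top.2 hfin, ENNReal.ofReal_ne_top⟩) hmain).trans_eq ?_
    rw [ENNReal.toReal_add (ENNReal.sum_ne_top.2 hfin) ENNReal.ofReal_ne_top,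
      ENNReal.toReal_sum hfin,
      ENNReal.toReal_ofReal (mul_nonneg (by positivity) (mul_nonneg hC (hN _)))]
    congr 1
    refine Finset.sum_congr rfl fun k _ => ?_
    rw [ENNReal.toReal_mul, ENNReal.toReal_ofReal (by positivity)]

theorem IsTame.mul_sin [IsFiniteMeasure μ] (hμ : Carleman μ) {h : (Fin n → ℝ) → ℂ}
    (t : IsTame μ h) (i : Fin n) {s : ℝ} (hs : 0 ≤ s) :
    IsTame μ fun x => h x * (Real.sin (s * x i) : ℂ) := by
  have hpos := (t.mul_exp hμ i (w := Complex.I) (by simp) (by simp) hs).const_mul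
    (-Complex.I / 2)
  have hneg := (t.mul_exp hμ i (w := -Complex.I) (by simp) (by simp) hs).const_mul
    (Complex.I / 2)
  convert! hpos.add hneg using 2 with x
  rw [Complex.ofReal_sin, Complex.sin]
  push_cast
  ring_nf

theorem isTame_eval_sin [IsFiniteMeasure μ] (hμ : Carleman μ) (F : MvPolynomial (Fin n) ℝ)
    {s : ℝ} (hs : 0 ≤ s) :
    IsTame μ fun x => (MvPolynomial.eval (fun i => Real.sin (s * x i)) F : ℂ) := by
  induction F using MvPolynomial.induction_on with
  | C a => simpa using isTame_one.const_mul (μ := μ) (a : ℂ)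
  | add p₁ p₂ h₁ h₂ => simpa only [map_add, Complex.ofReal_add] using h₁.add h₂
  | mul_X p i h =>
    simpa only [map_mul, MvPolynomial.eval_X, Complex.ofReal_mul] using h.mul_sin hμ i hs

/-! ### Approximation by polynomials in sines -/

/-- The Stone–Weierstrass theorem for polynomials on the cube `[-1, 1]ⁿ`. -/
theorem exists_eval_near_on_cube {f : (Fin n → ℝ) → ℝ} (hf : Continuous f) {δ : ℝ} (hδ : 0 < δ) :
    ∃ F : MvPolynomial (Fin n) ℝ, ∀ u : Fin n → ℝ, (∀ i, |u i| ≤ 1) →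
      |MvPolynomial.eval u F - f u| < δ := by
  set K := Metric.closedBall (0 : Fin n → ℝ) 1
  have : CompactSpace K := isCompact_iff_compactSpace.1 (isCompact_closedBall _ _)
  set X : Fin n → C(K, ℝ) := fun i => ⟨fun u => u.1 i, (continuous_apply i).comp continuous_subtype_val⟩
    with hX
  have heval : ∀ (F : MvPolynomial (Fin n) ℝ) (u : K),
      MvPolynomial.aeval X F u = MvPolynomial.eval u.1 F := by
    intro F u
    induction F using MvPolynomial.induction_on with
    | C a => simp
    | add p q hp hq => simp [hp, hq]
    | mul_X p i hp => rw [map_mul, map_mul, ContinuousMap.mul_apply, hp]; simp [hX]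
  have hsep : (MvPolynomial.aeval (R := ℝ) X).range.SeparatesPoints := by
    intro u v huv
    obtain ⟨i, hi⟩ := Function.ne_iff.1 (Subtype.coe_ne_coe.2 huv)
    exact ⟨X i, ⟨X i, ⟨MvPolynomial.X i, by simp⟩, rfl⟩, hi⟩
  obtain ⟨⟨_, F, rfl⟩, hF⟩ := ContinuousMap.exists_mem_subalgebra_near_continuousMap_of_separatesPoints
    _ hsep (⟨fun u : K => f u.1, by fun_prop⟩ : C(K, ℝ)) δ hδ
  refine ⟨F, fun u hu => ?_⟩
  have huK : u ∈ K := by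
    rw [mem_closedBall_zero_iff, pi_norm_le_iff_of_nonneg zero_le_one]
    exact hu
  refine lt_of_le_of_lt ?_ hF
  have h := ContinuousMap.norm_coe_le_norm
    (MvPolynomial.aeval X F - (⟨fun u : K => f u.1, by fun_prop⟩ : C(K, ℝ))) ⟨u, huK⟩
  simpa [heval] using h

theorem tendsto_rescaled_sin (y : ℝ) :
    Filter.Tendsto (fun m : ℕ => ((m : ℝ) + 1) * Real.sin (1 / ((m : ℝ) + 1) * y)) Filter.atTop
      (nhds y) := by
  have heq : ∀ m : ℕ, ((m : ℝ) + 1) * Real.sin (1 / ((m : ℝ) + 1) * y) =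
      y * Real.sinc (1 / ((m : ℝ) + 1) * y) := by
    intro m
    have hm : (m : ℝ) + 1 ≠ 0 := by positivity
    rcases eq_or_ne y 0 with rfl | hy
    · simp
    · rw [Real.sinc_of_ne_zero (by positivity)]
      field_simp
  simp_rw [heq]
  have h0 : Filter.Tendsto (fun m : ℕ => 1 / ((m : ℝ) + 1) * y) Filter.atTop (nhds 0) := by
    simpa using tendsto_one_div_add_atTop_nhds_zero_nat.mul_const y
  simpa using ((Real.continuous_sinc.tendsto 0).comp h0).const_mul y

theorem abs_rescaled_sin_le (m : ℕ) (y : ℝ) :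
    |((m : ℝ) + 1) * Real.sin (1 / ((m : ℝ) + 1) * y)| ≤ |y| := by
  have hm : (0 : ℝ) < (m : ℝ) + 1 := by positivity
  rw [abs_mul, abs_of_pos hm]
  calc ((m : ℝ) + 1) * |Real.sin (1 / ((m : ℝ) + 1) * y)|
      ≤ ((m : ℝ) + 1) * |1 / ((m : ℝ) + 1) * y| :=
        mul_le_mul_of_nonneg_left Real.abs_sin_le_abs hm.le
    _ = |y| := by
      rw [abs_mul, abs_of_pos (by positivity : 0 < 1 / ((m : ℝ) + 1))]
      field_simp

/-- Dominated convergence along the maps `x ↦ (R sin (x_i / R))_i`, which tend to the identity as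
`R → ∞` and never increase the absolute value of a coordinate. -/
theorem tendsto_eLpNorm_rescaled_sin [IsFiniteMeasure μ] {f G : (Fin n → ℝ) → ℝ}
    (hf : Continuous f) (hG : MemLp G 4 μ)
    (hfG : ∀ x y : Fin n → ℝ, (∀ i, |y i| ≤ |x i|) → |f y| ≤ G x) :
    Filter.Tendsto (fun m : ℕ => eLpNorm
      (fun x => f (fun i => ((m : ℝ) + 1) * Real.sin (1 / ((m : ℝ) + 1) * x i)) - f x) 4 μ)
      Filter.atTop (nhds 0) := by
  have hlint : Filter.Tendsto (fun m : ℕ => ∫⁻ x,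
      ‖f (fun i => ((m : ℝ) + 1) * Real.sin (1 / ((m : ℝ) + 1) * x i)) - f x‖ₑ ^ (4 : ℝ) ∂μ)
      Filter.atTop (nhds (∫⁻ _, 0 ∂μ)) := by
    refine tendsto_lintegral_of_dominated_convergence' (fun x => ‖2 * G x‖ₑ ^ (4 : ℝ))
      (fun m => ?_) (fun m => .of_forall fun x => ?_) ?_ (.of_forall fun x => ?_)
    · have : Continuous fun x : Fin n → ℝ =>
          f (fun i => ((m : ℝ) + 1) * Real.sin (1 / ((m : ℝ) + 1) * x i)) - f x := by fun_prop
      exact (this.measurable.enorm.pow_const _).aemeasurable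
    · dsimp only
      gcongr
      rw [enorm_le_iff_norm_le]
      have h1 := hfG x _ fun i => abs_rescaled_sin_le m (x i)
      have h2 := hfG x x fun i => le_rfl
      refine (norm_sub_le _ _).trans (le_trans ?_ (le_abs_self _))
      rw [Real.norm_eq_abs, Real.norm_eq_abs]
      linarith
    · have := (hG.const_mul 2).2
      rw [eLpNorm_lt_top_iff_lintegral_rpow_enorm_lt_top (by simp) (by simp)] at this
      simpa using this.ne
    · have h1 : Filter.Tendsto (fun m : ℕ =>
          f (fun i => ((m : ℝ) + 1) * Real.sin (1 / ((m : ℝ) + 1) * x i)) - f x)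
          Filter.atTop (nhds (f x - f x)) :=
        ((hf.tendsto x).comp (tendsto_pi_nhds.2 fun i => tendsto_rescaled_sin (x i))).sub_const _
      rw [sub_self] at h1
      have h2 := (h1.enorm).ennrpow_const 4
      simpa using h2
  rw [lintegral_zero] at hlint
  have h := hlint.ennrpow_const (1 / 4 : ℝ)
  rw [ENNReal.zero_rpow_of_pos (by norm_num)] at h
  simpa [eLpNorm_eq_lintegral_rpow_enorm_toReal] using h

theorem eLpNorm_four_sub_le {f g h : (Fin n → ℝ) → ℝ} (hf : Continuous f) (hg : Continuous g)
    (hh : Continuous h) : eLpNorm (fun x => f x - h x) 4 μ ≤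
      eLpNorm (fun x => f x - g x) 4 μ + eLpNorm (fun x => g x - h x) 4 μ := by
  calc eLpNorm (fun x => f x - h x) 4 μ
      = eLpNorm ((fun x => f x - g x) + fun x => g x - h x) 4 μ := by
        congr 1
        ext x
        simp
    _ ≤ _ := eLpNorm_add_le (hf.sub hg).aestronglyMeasurable (hg.sub hh).aestronglyMeasurable
        (by norm_num)

/-- A continuous function dominated on boxes by a function in `L⁴(μ)` is a limit of polynomials in
`L⁴(μ)`: it is close to its composition with a rescaled sine, which is uniformly close to a polynomial
in sines, which is tame. -/
theorem exists_eLpNorm_sub_eval_lt [IsFiniteMeasure μ] (hμ : Carleman μ)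
    {f G : (Fin n → ℝ) → ℝ} (hf : Continuous f) (hG : MemLp G 4 μ)
    (hfG : ∀ x y : Fin n → ℝ, (∀ i, |y i| ≤ |x i|) → |f y| ≤ G x)
    {ε : ENNReal} (hε : ε ≠ 0) :
    ∃ A : MvPolynomial (Fin n) ℝ, eLpNorm (fun x => f x - MvPolynomial.eval x A) 4 μ < ε := by
  have hε3 : ε / 3 ≠ 0 := by simp [hε]
  obtain ⟨m, hm⟩ := ((tendsto_eLpNorm_rescaled_sin hf hG hfG).eventually_lt_const
    (pos_iff_ne_zero.2 hε3)).exists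
  obtain ⟨δ, hδ, hδε⟩ := ENNReal.exists_nnreal_pos_mul_lt
    (a := μ Set.univ ^ (ENNReal.toReal 4)⁻¹) (by finiteness) hε3
  obtain ⟨F, hF⟩ := exists_eval_near_on_cube
    (f := fun u => f fun i => ((m : ℝ) + 1) * u i) (by fun_prop) (NNReal.coe_pos.2 hδ)
  set S : (Fin n → ℝ) → Fin n → ℝ := fun x i => Real.sin (1 / ((m : ℝ) + 1) * x i) with hS
  have hSc : Continuous S := by fun_prop
  have htame := (isTame_eval_sin hμ F (s := 1 / ((m : ℝ) + 1)) (by positivity)).polyDist_mul 1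
  simp only [map_one, Complex.ofReal_one, one_mul] at htame
  obtain ⟨A, B, hAB⟩ := exists_eLpNorm_sub_lt (htame.trans_lt (pos_iff_ne_zero.2 hε3))
  have hA : eLpNorm (fun x => MvPolynomial.eval (S x) F - MvPolynomial.eval x A) 4 μ < ε / 3 := by
    refine (eLpNorm_mono fun x => ?_).trans_lt hAB
    refine le_trans (le_of_eq ?_) (Complex.abs_re_le_norm _)
    rw [Real.norm_eq_abs]
    simp [complexEval, hS]
  have hFf : eLpNorm (fun x => f (fun i => ((m : ℝ) + 1) * S x i) - MvPolynomial.eval (S x) F) 4 μ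
      < ε / 3 := by
    refine (eLpNorm_le_of_ae_bound (C := δ) (.of_forall fun x => ?_)).trans_lt ?_
    · rw [norm_sub_rev]
      exact (hF (S x) fun i => Real.abs_sin_le_one _).le
    · rwa [ENNReal.ofReal_coe_nnreal, mul_comm]
  have hm' : eLpNorm (fun x => f x - f (fun i => ((m : ℝ) + 1) * S x i)) 4 μ < ε / 3 := by
    rw [← eLpNorm_neg]
    convert! hm using 2
    ext x
    simp [hS]
  refine ⟨A, ?_⟩
  have hAc := continuous_eval A
  have hFc : Continuous fun x => MvPolynomial.eval (S x) F := (continuous_eval F).comp hSc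
  have hfS : Continuous fun x => f (fun i => ((m : ℝ) + 1) * S x i) := by fun_prop
  calc eLpNorm (fun x => f x - MvPolynomial.eval x A) 4 μ
      ≤ eLpNorm (fun x => f x - f (fun i => ((m : ℝ) + 1) * S x i)) 4 μ +
          (eLpNorm (fun x => f (fun i => ((m : ℝ) + 1) * S x i) - MvPolynomial.eval (S x) F) 4 μ +
          eLpNorm (fun x => MvPolynomial.eval (S x) F - MvPolynomial.eval x A) 4 μ) :=
        (eLpNorm_four_sub_le hf hfS hAc).trans
          (add_le_add_right (eLpNorm_four_sub_le hfS hFc hAc) _)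
    _ < ε / 3 + (ε / 3 + ε / 3) := ENNReal.add_lt_add hm' (ENNReal.add_lt_add hFf hA)
    _ = ε := by rw [← add_assoc, ENNReal.add_thirds]

/-! ### Density of the sums of squares -/

theorem sosPolys_subset_nonnegPolys (n : ℕ) : sosPolys n ⊆ nonnegPolys n := by
  intro p hp x
  induction hp with
  | zero => simp
  | sq_add a _ ih =>
    rw [map_add, map_mul]
    exact add_nonneg (mul_self_nonneg _) ih

/-- Hölder's inequality for `f² - a² = (f - a) (f + a)`, with `f + a = 2 f - (f - a)`. -/
theorem eLpNorm_mul_self_sub_mul_self_le {f a : (Fin n → ℝ) → ℝ} (hf : Continuous f)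
    (ha : Continuous a) : eLpNorm (fun x => f x * f x - a x * a x) 2 μ ≤
      eLpNorm (fun x => f x - a x) 4 μ *
        (eLpNorm f 4 μ + eLpNorm f 4 μ + eLpNorm (fun x => f x - a x) 4 μ) := by
  have hd : Continuous (f - a) := hf.sub ha
  have hs : Continuous (f + a) := hf.add ha
  have hhold : ENNReal.HolderTriple 4 4 2 := by
    have := holderTriple_mul_two 2
    norm_num at this
    exact this
  have hsum : eLpNorm (f + a) 4 μ ≤ eLpNorm f 4 μ + eLpNorm f 4 μ + eLpNorm (f - a) 4 μ := by
    rw [show f + a = f + f - (f - a) by abel]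
    refine (eLpNorm_sub_le (hf.add hf).aestronglyMeasurable hd.aestronglyMeasurable
      (by norm_num)).trans (add_le_add_left ?_ _)
    exact eLpNorm_add_le hf.aestronglyMeasurable hf.aestronglyMeasurable (by norm_num)
  calc eLpNorm (fun x => f x * f x - a x * a x) 2 μ = eLpNorm ((f - a) • (f + a)) 2 μ := by
        congr 1
        ext x
        simp only [Pi.smul_apply', Pi.sub_apply, Pi.add_apply, smul_eq_mul]
        ring
    _ ≤ eLpNorm (f - a) 4 μ * eLpNorm (f + a) 4 μ :=
        eLpNorm_smul_le_mul_eLpNorm hs.aestronglyMeasurable hd.aestronglyMeasurable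
    _ ≤ _ := mul_le_mul_right hsum _

/-- A nonnegative polynomial `p` is an `L²(μ)`-limit of single squares `A²`: take `A` close to `√p` in
`L⁴(μ)`. -/
theorem exists_sq_near [IsFiniteMeasure μ] (hμ : Carleman μ) {p : MvPolynomial (Fin n) ℝ}
    (hp : p ∈ nonnegPolys n) {ε : ENNReal} (hε : ε ≠ 0) :
    ∃ A : MvPolynomial (Fin n) ℝ,
      eLpNorm (fun x => MvPolynomial.eval x p - MvPolynomial.eval x (A * A)) 2 μ < ε := by
  obtain ⟨G, hG, hpG⟩ := exists_monotone_bound hμ p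
  set f : (Fin n → ℝ) → ℝ := fun x => √(MvPolynomial.eval x p) with hfdef
  have hf : Continuous f := (continuous_eval p).sqrt
  have hG4 : MemLp (fun x => 1 + G x) 4 μ := by
    have h1 : MemLp (fun _ : Fin n → ℝ => (1 : ℝ)) 4 μ := memLp_const 1
    exact h1.add (hG 4 (by simp))
  have hfG : ∀ x y : Fin n → ℝ, (∀ i, |y i| ≤ |x i|) → |f y| ≤ 1 + G x := by
    intro x y hxy
    rw [abs_of_nonneg (Real.sqrt_nonneg _)]
    have h1 := (le_abs_self _).trans (hpG x y hxy)
    refine Real.sqrt_le_iff.2 ⟨by linarith [hp y], ?_⟩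
    nlinarith [hp y]
  have hf4 : MemLp f 4 μ := hG4.mono' hf.aestronglyMeasurable
    (.of_forall fun x => hfG x x fun _ => le_rfl)
  -- With `‖f - A‖₄ ≤ 1`, the factor `‖f + A‖₄` is at most `K`.
  set K := eLpNorm f 4 μ + eLpNorm f 4 μ + 1 with hK
  have hKtop : K ≠ ⊤ := by
    have := hf4.2.ne
    finiteness
  have hK0 : K ≠ 0 := by simp [hK]
  have hη : min 1 (ε / K) ≠ 0 := by
    simp [hε, hKtop]
  obtain ⟨A, hA⟩ := exists_eLpNorm_sub_eval_lt hμ hf hG4 hfG hη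
  refine ⟨A, ?_⟩
  calc eLpNorm (fun x => MvPolynomial.eval x p - MvPolynomial.eval x (A * A)) 2 μ
      = eLpNorm (fun x => f x * f x - MvPolynomial.eval x A * MvPolynomial.eval x A) 2 μ := by
        congr 1
        ext x
        rw [map_mul, hfdef, Real.mul_self_sqrt (hp x)]
    _ ≤ eLpNorm (fun x => f x - MvPolynomial.eval x A) 4 μ *
          (eLpNorm f 4 μ + eLpNorm f 4 μ + eLpNorm (fun x => f x - MvPolynomial.eval x A) 4 μ) :=
        eLpNorm_mul_self_sub_mul_self_le hf (continuous_eval A)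
    _ ≤ eLpNorm (fun x => f x - MvPolynomial.eval x A) 4 μ * K := by
        rw [hK]
        gcongr
        exact hA.le.trans (min_le_left _ _)
    _ < ε := (ENNReal.lt_div_iff_mul_lt (Or.inl hK0) (Or.inl hKtop)).1
        (hA.trans_le (min_le_right _ _))

end SOSDensity

theorem mainTheorem2 (n : ℕ) (μ : Measure (Fin n → ℝ)) [IsFiniteMeasure μ]
    (hμ : SOSDensity.Carleman μ) :
    -- every polynomial is square integrable
    (∀ p : MvPolynomial (Fin n) ℝ, MemLp (fun x => MvPolynomial.eval x p) 2 μ) ∧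
    -- `Σ` is a subset of `P`, dense in `P` for the topology of `L²(μ)`
    SOSDensity.sosPolys n ⊆ SOSDensity.nonnegPolys n ∧
    SOSDensity.classesL2 μ (SOSDensity.nonnegPolys n) ⊆
      closure (SOSDensity.classesL2 μ (SOSDensity.sosPolys n)) ∧
    -- the same in terms of `ε`
    (∀ p ∈ SOSDensity.nonnegPolys n, ∀ ε : ℝ, 0 < ε →
      ∃ s ∈ SOSDensity.sosPolys n,
        eLpNorm (fun x => MvPolynomial.eval x p - MvPolynomial.eval x s) 2 μ
          < ENNReal.ofReal ε) := by
  have hmem := fun p : MvPolynomial (Fin n) ℝ => SOSDensity.memLp_eval hμ p (q := 2) (by simp)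
  have hdense : ∀ p ∈ SOSDensity.nonnegPolys n, ∀ ε : ENNReal, ε ≠ 0 →
      ∃ s ∈ SOSDensity.sosPolys n,
        eLpNorm (fun x => MvPolynomial.eval x p - MvPolynomial.eval x s) 2 μ < ε := by
    intro p hp ε hε
    obtain ⟨A, hA⟩ := SOSDensity.exists_sq_near hμ hp hε
    exact ⟨A * A, IsSumSq.mul_self A, hA⟩
  refine ⟨hmem, SOSDensity.sosPolys_subset_nonnegPolys n, ?_, fun p hp ε hε =>
    hdense p hp _ (by simpa using hε)⟩
  rintro g ⟨p, hp, hg⟩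
  refine EMetric.mem_closure_iff.2 fun ε hε => ?_
  obtain ⟨s, hs, hlt⟩ := hdense p hp ε hε.ne'
  refine ⟨(hmem s).toLp _, ⟨s, hs, (hmem s).coeFn_toLp⟩, ?_⟩
  rw [Lp.edist_def]
  refine (eLpNorm_congr_ae ?_).trans_lt hlt
  filter_upwards [hg, (hmem s).coeFn_toLp] with x h₁ h₂
  simp [h₁, h₂]
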